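/- Let $A$ be a uniform algebra on a compact Hausdorff space $K$, that is, a subalgebra of $C(K)$ (the continuous complex-valued functions on $K$, with the supremum norm) which contains the constants and separates the points of $K$. The Choquet boundary $Ch(A)$ is the set of points $x\in K$ whose evaluation functional $a\mapsto a(x)$ is an extreme point of the closed unit ball of the dual space $A^*$, and the Shilov boundary of $A$ is $\Omega=\partial A=\overline{Ch(A)}$. Let $A^{-1}$ be the group of invertible elements of $A$ and let $Q=\{|g|_{|\Omega} : g\in A^{-1}\}$. For a strictly positive continuous function $f$ on $\Omega$ let $Af=\{a_{|\Omega}f : a\in A\}\subset C(\Omega)$, with the supremum norm over $\Omega$ and the $A$-module structure $a\cdot h=a_{|\Omega}h$. Two normed $A$-modules are $A$-isometric if there is an $A$-linear isometry of one onto the other; two normed spaces are linearly isometric if there is a $\mathbb{C}$-linear isometry of one onto the other. (1) For every strictly positive $f\in C(\Omega)$ the following conditions are equivalent: (a) $f\in Q$, i.e. $f=|g|$ on $\Omega$ for some $g\in A^{-1}$; (b) $A$ and $Af$ are $A$-isometric; (c) $A$ and $Af$ are linearly isometric. (2) For all strictly positive $f_1,f_2\in C(\Omega)$, the modules $Af_1$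 and $Af_2$ are $A$-isometric if and only if $f_1/f_2\in Q$. -/

import Mathlib

noncomputable section

namespace FunctionAlgebra

variable {K : Type*} [TopologicalSpace K] [CompactSpace K]

/-- Evaluation at `x`, as a bounded linear functional on the subalgebra `A` of `C(K)`
(with the supremum norm). -/
def evalFunctional (A : Subalgebra ℂ C(K, ℂ)) (x : K) : StrongDual ℂ A :=
  (ContinuousMap.evalCLM ℂ x).comp A.toSubmodule.subtypeL

/-- The Choquet boundary `Ch(A)`: the points whose evaluation functional is an extreme point of
the closed unit ball of the dual space of `A`. -/
def choquetBoundary (A : Subalgebra ℂ C(K, ℂ)) : Set K :=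
  {x | evalFunctional A x ∈
    Set.extremePoints ℝ {F : StrongDual ℂ A | ‖F‖ ≤ 1}}

/-- The Shilov boundary `∂A`: the closure of the Choquet boundary. -/
def shilovBoundary (A : Subalgebra ℂ C(K, ℂ)) : Set K :=
  closure (choquetBoundary A)

instance (A : Subalgebra ℂ C(K, ℂ)) : CompactSpace (shilovBoundary A) :=
  isCompact_iff_compactSpace.mp isClosed_closure.isCompact

/-- Restriction of the elements of `A` to `S ⊆ K`, as a homomorphism of algebras. -/
def restrictHom (A : Subalgebra ℂ C(K, ℂ)) (S : Set K) : A →ₐ[ℂ] C(S, ℂ) :=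
  (ContinuousMap.compRightAlgHom ℂ ℂ ⟨Subtype.val, continuous_subtype_val⟩).comp A.val

/-- A real continuous function, regarded as a complex one. -/
def toComplex {S : Set K} (f : C(S, ℝ)) : C(S, ℂ) :=
  ⟨fun x => (f x : ℂ), Complex.continuous_ofReal.comp f.continuous⟩

/-- The space `Af = {a f : a ∈ A}` of functions on `S`, with the supremum norm over `S`. -/
def moduleOf (A : Subalgebra ℂ C(K, ℂ)) {S : Set K} (f : C(S, ℝ)) : Submodule ℂ C(S, ℂ) where
  carrier := {h | ∃ a : A, h = restrictHom A S a * toComplex f}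
  zero_mem' := ⟨0, by simp⟩
  add_mem' := by
    rintro _ _ ⟨a, rfl⟩ ⟨b, rfl⟩
    exact ⟨a + b, by simp [add_mul]⟩
  smul_mem' := by
    rintro c _ ⟨a, rfl⟩
    exact ⟨c • a, by rw [map_smul, smul_mul_assoc]⟩

/-- `Af` is an `A`-module: `A` acts by restriction to `S` and pointwise multiplication. -/
instance moduleOfModule (A : Subalgebra ℂ C(K, ℂ)) {S : Set K} (f : C(S, ℝ)) :
    Module A (moduleOf A f) where
  smul a h := ⟨restrictHom A S a * h.1, by
    obtain ⟨b, hb⟩ := h.2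
    exact ⟨a * b, by rw [hb, map_mul, mul_assoc]⟩⟩
  one_smul h := Subtype.ext (show restrictHom A S 1 * h.1 = h.1 by rw [map_one, one_mul])
  mul_smul a b h := Subtype.ext
    (show restrictHom A S (a * b) * h.1 = restrictHom A S a * (restrictHom A S b * h.1) by
      rw [map_mul, mul_assoc])
  smul_zero a := Subtype.ext (mul_zero (restrictHom A S a))
  smul_add a h k := Subtype.ext (mul_add (restrictHom A S a) h.1 k.1)
  add_smul a b h := Subtype.ext
    (show restrictHom A S (a + b) * h.1 = restrictHom A S a * h.1 + restrictHom A S b * h.1 by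
      rw [map_add, add_mul])
  zero_smul h := Subtype.ext (show restrictHom A S 0 * h.1 = 0 by rw [map_zero, zero_mul])

/-- The set `Q` on `S`: the restrictions to `S` of the functions `|g|`, with `g` invertible
in `A`. -/
def Q (A : Subalgebra ℂ C(K, ℂ)) (S : Set K) : Set (S → ℝ) :=
  {u | ∃ g : Aˣ, ∀ x : S, u x = ‖((g : A) : C(K, ℂ)) x‖}

/-- Two normed spaces are linearly isometric. -/
def LinearlyIsometric (X Y : Type*) [SeminormedAddCommGroup X] [SeminormedAddCommGroup Y]
    [Module ℂ X] [Module ℂ Y] : Prop :=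
  Nonempty (X ≃ₗᵢ[ℂ] Y)

/-- Two normed `R`-modules are `R`-isometric: there is an `R`-linear isometry of one onto
the other. -/
def ModuleIsometric (R X Y : Type*) [Ring R] [SeminormedAddCommGroup X]
    [SeminormedAddCommGroup Y] [Module R X] [Module R Y] : Prop :=
  Nonempty (X ≃ₗᵢ[R] Y)

end FunctionAlgebra

end

/-! The extreme points of the dual ball of `C(X)` are unimodular multiples of evaluations, and
Krein–Milman with Hahn–Banach carries this over to every subspace (`exists_eq_mul_evalOn`). So a
linear isometry between function spaces is a weighted composition `(T a)(x) = c a(y)`, `|c| = 1`, at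
each `x` whose evaluation is extreme. Such points for `Af` are dense in the Shilov boundary
(`dense_extremeSet`), so pointwise identities proved there extend to all of it, and then to `A`,
because restriction to the boundary is injective. For `T : A → Af` put `T 1 = h f`, `T b = f`, `T
(b²) = k f`. The weighted form gives `h k = 1` and `|h| f = 1`, hence `f = |k|`. An `A`-linear
isometry `Af₁ → Af₂` is multiplication by some `h f₂ / f₁` with `h` invertible; separation of points
forces `y = x`, so `|h| = f₁ / f₂`. Conversely, multiplication by a unimodular function is
isometric. -/

noncomputable section

namespace FunctionAlgebra

/-! ### Extreme points of dual balls of function spaces. -/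

section ExtremeFunctionals

variable {E : Type*} [NormedAddCommGroup E] [NormedSpace ℂ E]

/-- The closed unit ball of the dual of `E`. -/
def dualBall (E : Type*) [NormedAddCommGroup E] [NormedSpace ℂ E] : Set (StrongDual ℂ E) :=
  {F | ‖F‖ ≤ 1}

/-- The closed unit ball of the dual, as a subset of the weak dual. -/
def weakDualBall (E : Type*) [NormedAddCommGroup E] [NormedSpace ℂ E] : Set (WeakDual ℂ E) :=
  WeakDual.toStrongDual ⁻¹' dualBall E

instance : LocallyConvexSpace ℝ (WeakDual ℂ E) :=
  inferInstanceAs (LocallyConvexSpace ℝ (WeakBilin (topDualPairing ℂ E)))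

theorem isCompact_weakDualBall : IsCompact (weakDualBall E) := by
  have h := WeakDual.isCompact_closedBall (𝕜 := ℂ) (0 : StrongDual ℂ E) 1
  convert h using 1
  ext F
  simp [weakDualBall, dualBall]

theorem toWeakDual_mem_extremePoints {F : StrongDual ℂ E}
    (hF : F ∈ Set.extremePoints ℝ (dualBall E)) :
    StrongDual.toWeakDual F ∈ Set.extremePoints ℝ (weakDualBall E) := hF

theorem norm_eq_one_of_mem_extremePoints {F : StrongDual ℂ E}
    (hF : F ∈ Set.extremePoints ℝ (dualBall E)) (hF0 : F ≠ 0) : ‖F‖ = 1 := by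
  have : Nontrivial (StrongDual ℂ E) := ⟨F, 0, hF0⟩
  have hB : dualBall E = Metric.closedBall 0 1 := by
    ext G; simp [dualBall]
  rw [hB] at hF
  simpa using extremePoints_closedBall_subset_sphere hF

theorem smul_mem_extremePoints {F : StrongDual ℂ E} (hF : F ∈ Set.extremePoints ℝ (dualBall E))
    {c : ℂ} (hc : ‖c‖ = 1) : c • F ∈ Set.extremePoints ℝ (dualBall E) := by
  have hc0 : c ≠ 0 := by rintro rfl; simp at hc
  refine ⟨by simpa [dualBall, norm_smul, hc] using hF.1, fun G₁ h₁ G₂ h₂ h => ?_⟩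
  have key : c⁻¹ • G₁ = F := by
    refine hF.2 (x₁ := c⁻¹ • G₁) (x₂ := c⁻¹ • G₂) ?_ ?_ ?_
    · simpa [dualBall, norm_smul, hc] using h₁
    · simpa [dualBall, norm_smul, hc] using h₂
    · obtain ⟨a, b, ha, hb, hab, h⟩ := h
      refine ⟨a, b, ha, hb, hab, ?_⟩
      rw [smul_comm a, smul_comm b, ← smul_add c⁻¹ (a • G₁), h, inv_smul_smul₀ hc0]
  rw [← key, smul_inv_smul₀ hc0]

/-- Linear isometries transport extreme functionals. -/
theorem comp_mem_extremePoints {F : Type*} [NormedAddCommGroup F] [NormedSpace ℂ F]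
    (T : E ≃ₗᵢ[ℂ] F) {φ : StrongDual ℂ F} (hφ : φ ∈ Set.extremePoints ℝ (dualBall F)) :
    φ.comp (T.toContinuousLinearEquiv : E →L[ℂ] F) ∈ Set.extremePoints ℝ (dualBall E) := by
  have hle : ∀ {ψ : StrongDual ℂ F}, ‖ψ‖ ≤ 1 →
      ‖ψ.comp (T.toContinuousLinearEquiv : E →L[ℂ] F)‖ ≤ 1 := fun {ψ} h =>
    ContinuousLinearMap.opNorm_le_bound _ zero_le_one fun e => by
      simpa using ψ.le_of_opNorm_le h (T e)
  have hle' : ∀ {ψ : StrongDual ℂ E}, ‖ψ‖ ≤ 1 →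
      ‖ψ.comp (T.symm.toContinuousLinearEquiv : F →L[ℂ] E)‖ ≤ 1 := fun {ψ} h =>
    ContinuousLinearMap.opNorm_le_bound _ zero_le_one fun e => by
      simpa using ψ.le_of_opNorm_le h (T.symm e)
  refine ⟨hle hφ.1, fun G₁ h₁ G₂ h₂ ⟨a, b, ha, hb, hab, h⟩ => ?_⟩
  have := hφ.2 (hle' h₁) (hle' h₂) ⟨a, b, ha, hb, hab, by
    ext y
    simpa using DFunLike.congr_fun h (T.symm y)⟩
  ext e
  simpa using DFunLike.congr_fun this (T e)

theorem exists_extension_mem_dualBall {F : Type*} [NormedAddCommGroup F] [NormedSpace ℂ F]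
    (J : E →ₗᵢ[ℂ] F) {ψ : StrongDual ℂ E} (hψ : ψ ∈ dualBall E) :
    ∃ L ∈ dualBall F, ∀ e, L (J e) = ψ e := by
  let T : E ≃ₗᵢ[ℂ] LinearMap.range J.toLinearMap := J.equivRange
  obtain ⟨L, hL, hLn⟩ := exists_extension_norm_eq (LinearMap.range J.toLinearMap)
    (ψ.comp (T.symm.toContinuousLinearEquiv : LinearMap.range J.toLinearMap →L[ℂ] E))
  refine ⟨L, ?_, fun e => ?_⟩
  · change ‖L‖ ≤ 1
    rw [hLn]
    refine ContinuousLinearMap.opNorm_le_bound _ zero_le_one fun y => ?_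
    rw [← T.symm.norm_map y]
    exact ψ.le_of_opNorm_le hψ (T.symm y)
  · refine (hL (T e)).trans ?_
    change ψ (T.symm (T e)) = ψ e
    rw [T.symm_apply_apply]

section ContinuousFunctions

variable {X : Type*} [TopologicalSpace X] [CompactSpace X]

/-- After adjusting phases, two test functions glue to `ρ c₁ g₁ + (1 - ρ) c₂ g₂`, a pointwise convex
combination and hence in the unit ball, on which `L` takes the value `‖L₁ g₁‖ + ‖L₂ g₂‖`. -/
theorem norm_add_norm_le_of_convex {L : StrongDual ℂ C(X, ℂ)} (hL : ‖L‖ ≤ 1) {ρ : C(X, ℂ)}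
    (hρ : ∀ x, ∃ t : ℝ, 0 ≤ t ∧ t ≤ 1 ∧ ρ x = t) :
    ‖L.comp (ContinuousLinearMap.mul ℂ C(X, ℂ) ρ)‖ +
      ‖L.comp (ContinuousLinearMap.mul ℂ C(X, ℂ) (1 - ρ))‖ ≤ 1 := by
  set L₁ := L.comp (ContinuousLinearMap.mul ℂ C(X, ℂ) ρ)
  set L₂ := L.comp (ContinuousLinearMap.mul ℂ C(X, ℂ) (1 - ρ))
  have phase : ∀ z : ℂ, ∃ c : ℂ, ‖c‖ ≤ 1 ∧ c * z = ‖z‖ := fun z => by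
    by_cases hz : z = 0
    · exact ⟨0, by simp, by simp [hz]⟩
    · refine ⟨(‖z‖ : ℂ) / z, ?_, div_mul_cancel₀ _ hz⟩
      simp [norm_ne_zero_iff.2 hz]
  have key : ∀ g₁ g₂ : C(X, ℂ), ‖g₁‖ ≤ 1 → ‖g₂‖ ≤ 1 → ‖L₁ g₁‖ + ‖L₂ g₂‖ ≤ 1 := by
    intro g₁ g₂ h₁ h₂
    obtain ⟨c₁, hc₁, e₁⟩ := phase (L₁ g₁)
    obtain ⟨c₂, hc₂, e₂⟩ := phase (L₂ g₂)
    set g : C(X, ℂ) := ρ * (c₁ • g₁) + (1 - ρ) * (c₂ • g₂)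
    have hg : ‖g‖ ≤ 1 := by
      refine (ContinuousMap.norm_le _ zero_le_one).2 fun x => ?_
      obtain ⟨t, ht0, ht1, ht⟩ := hρ x
      have b₁ : ‖c₁ * g₁ x‖ ≤ 1 := by
        rw [norm_mul]
        exact mul_le_one₀ hc₁ (norm_nonneg _) ((g₁.norm_coe_le_norm x).trans h₁)
      have b₂ : ‖c₂ * g₂ x‖ ≤ 1 := by
        rw [norm_mul]
        exact mul_le_one₀ hc₂ (norm_nonneg _) ((g₂.norm_coe_le_norm x).trans h₂)
      have : g x = (t : ℂ) * (c₁ * g₁ x) + ((1 - t : ℝ) : ℂ) * (c₂ * g₂ x) := by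
        simp [g, ht]
        ring
      rw [this]
      refine (norm_add_le _ _).trans ?_
      rw [norm_mul (t : ℂ), norm_mul ((1 - t : ℝ) : ℂ), Complex.norm_real, Complex.norm_real,
        Real.norm_of_nonneg ht0, Real.norm_of_nonneg (sub_nonneg.2 ht1)]
      nlinarith
    have hLg : L g = ((‖L₁ g₁‖ + ‖L₂ g₂‖ : ℝ) : ℂ) := by
      have : L g = c₁ * L₁ g₁ + c₂ * L₂ g₂ := by
        simp only [g, L₁, L₂, map_add, mul_smul_comm, map_smul, smul_eq_mul,
          ContinuousLinearMap.comp_apply, ContinuousLinearMap.mul_apply']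
      rw [this, e₁, e₂]; push_cast; rfl
    have := L.le_of_opNorm_le_of_le hL hg
    rw [hLg, Complex.norm_real, Real.norm_of_nonneg (by positivity)] at this
    simpa using this
  have step : ∀ g₂ : C(X, ℂ), ‖g₂‖ ≤ 1 → ‖L₁‖ + ‖L₂ g₂‖ ≤ 1 := by
    intro g₂ h₂
    rw [← le_sub_iff_add_le]
    refine ContinuousLinearMap.opNorm_le_of_unit_norm (𝕜 := ℝ) (f := L₁.restrictScalars ℝ) ?_ ?_
    · simpa using key 0 g₂ (by simp) h₂
    · intro g₁ h₁
      have := key g₁ g₂ h₁.le h₂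
      simp only [ContinuousLinearMap.coe_restrictScalars']
      linarith
  rw [add_comm, ← le_sub_iff_add_le]
  refine ContinuousLinearMap.opNorm_le_of_unit_norm (𝕜 := ℝ) (f := L₂.restrictScalars ℝ) ?_ ?_
  · simpa using step 0 (by simp)
  · intro g₂ h₂
    have := step g₂ h₂.le
    simp only [ContinuousLinearMap.coe_restrictScalars']
    linarith

/-- Norm additivity splits `L` into two pieces of complementary norm, which extremality forces to be
proportional to `L`. -/
theorem exists_apply_mul_eq_of_convex {L : StrongDual ℂ C(X, ℂ)}
    (hL : L ∈ Set.extremePoints ℝ (dualBall C(X, ℂ))) {ρ : C(X, ℂ)}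
    (hρ : ∀ x, ∃ t : ℝ, 0 ≤ t ∧ t ≤ 1 ∧ ρ x = t) : ∃ t : ℂ, ∀ g, L (ρ * g) = t * L g := by
  have hsum := norm_add_norm_le_of_convex hL.1 hρ
  set L₁ := L.comp (ContinuousLinearMap.mul ℂ C(X, ℂ) ρ)
  set L₂ := L.comp (ContinuousLinearMap.mul ℂ C(X, ℂ) (1 - ρ))
  have hadd : L = L₁ + L₂ := by
    ext g
    simp [L₁, L₂]
  set t : ℝ := ‖L₁‖
  have ht : 0 ≤ t := norm_nonneg _
  have ht2 : ‖L₂‖ ≤ 1 - t := by linarith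
  have ht1 : t ≤ 1 := by linarith [norm_nonneg L₂]
  have bound : ∀ a b : ℝ, 0 ≤ a → 0 ≤ b → a * t + b * (1 - t) ≤ 1 →
      a • L₁ + b • L₂ ∈ dualBall C(X, ℂ) := by
    intro a b ha hb h
    refine (norm_add_le _ _).trans ?_
    rw [norm_smul, norm_smul, Real.norm_of_nonneg ha, Real.norm_of_nonneg hb]
    nlinarith
  -- The two functionals are `L ± ((1 - t) L₁ - t L₂)`, with midpoint `L`. This choice avoids
  -- dividing by `t` or `1 - t`, which may vanish.
  have := hL.2 (bound (2 - t) (1 - t) (by linarith) (by linarith) (by nlinarith))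
    (bound t (1 + t) ht (by linarith) (by nlinarith))
    ⟨1 / 2, 1 / 2, by norm_num, by norm_num, by norm_num, by
      conv_rhs => rw [hadd]
      module⟩
  refine ⟨t, fun g => ?_⟩
  have h1 : L₁ = t • L := by
    have h3 : L₁ = ((2 - t) • L₁ + (1 - t) • L₂) - (1 - t) • (L₁ + L₂) := by module
    rw [this, ← hadd] at h3
    rw [h3]
    module
  simpa [L₁] using DFunLike.congr_fun h1 g

/-- Real functions reduce to values in `[0, 1]` by an affine change; complex ones split into real
and imaginary parts. -/
theorem exists_apply_mul_eq {L : StrongDual ℂ C(X, ℂ)}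
    (hL : L ∈ Set.extremePoints ℝ (dualBall C(X, ℂ))) (h : C(X, ℂ)) :
    ∃ t : ℂ, ∀ g, L (h * g) = t * L g := by
  have real : ∀ u : C(X, ℝ), ∃ t : ℂ, ∀ g,
      L ((⟨fun x => (u x : ℂ), Complex.continuous_ofReal.comp u.continuous⟩ : C(X, ℂ)) * g) =
        t * L g := by
    intro u
    set M := ‖u‖ + 1
    have hM : 0 < M := by positivity
    set ρ : C(X, ℂ) := ⟨fun x => (((u x / M + 1) / 2 : ℝ) : ℂ), by fun_prop⟩
    have hρ : ∀ x, ∃ t : ℝ, 0 ≤ t ∧ t ≤ 1 ∧ ρ x = t := fun x => by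
      have hu := abs_le.1 (u.norm_coe_le_norm x)
      have h1 : -1 ≤ u x / M := by rw [le_div_iff₀ hM]; linarith
      have h2 : u x / M ≤ 1 := by rw [div_le_iff₀ hM]; linarith
      exact ⟨_, by linarith, by linarith, rfl⟩
    obtain ⟨t, ht⟩ := exists_apply_mul_eq_of_convex hL hρ
    refine ⟨M * (2 * t - 1), fun g => ?_⟩
    have : (⟨fun x => (u x : ℂ), Complex.continuous_ofReal.comp u.continuous⟩ : C(X, ℂ)) * g =
        (M : ℂ) • ((2 : ℂ) • (ρ * g) - g) := by
      ext x
      have : (M : ℂ) ≠ 0 := by exact_mod_cast hM.ne'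
      simp [ρ]
      field_simp
      ring
    rw [this, map_smul, map_sub, map_smul, ht]
    simp only [smul_eq_mul]
    ring
  obtain ⟨s, hs⟩ := real ⟨fun x => (h x).re, by fun_prop⟩
  obtain ⟨t, ht⟩ := real ⟨fun x => (h x).im, by fun_prop⟩
  refine ⟨s + Complex.I * t, fun g => ?_⟩
  rw [add_mul, mul_assoc, ← hs, ← ht, ← smul_eq_mul Complex.I, ← map_smul, ← map_add]
  congr 1
  ext x
  simp only [ContinuousMap.mul_apply, ContinuousMap.add_apply, ContinuousMap.smul_apply,
    ContinuousMap.coe_mk, smul_eq_mul]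
  conv_lhs => rw [← Complex.re_add_im (h x)]
  ring

/-- The nonzero extreme points of the unit ball of `C(X)*` are unimodular multiples of
evaluations. -/
theorem exists_eq_mul_eval [T2Space X] {L : StrongDual ℂ C(X, ℂ)}
    (hL : L ∈ Set.extremePoints ℝ (dualBall C(X, ℂ))) (hL0 : L ≠ 0) :
    ∃ (x : X) (c : ℂ), ‖c‖ = 1 ∧ ∀ g, L g = c * g x := by
  choose t ht using exists_apply_mul_eq hL
  have ht1 : ∀ h, L h = t h * L 1 := fun h => by simpa using ht h 1
  have hc : L 1 ≠ 0 := fun h0 => hL0 (by ext h; simp [ht1 h, h0])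
  have htL : ∀ h, t h = (L 1)⁻¹ * L h := fun h => by rw [ht1 h]; field_simp
  -- The proportionality makes `L / L 1` multiplicative, and characters of `C(X)` are evaluations.
  let χ : C(X, ℂ) →ₐ[ℂ] ℂ := AlgHom.ofLinearMap ((L 1)⁻¹ • L.toLinearMap)
    (by simp [hc])
    (fun f g => by
      have := ht f g
      rw [htL] at this
      simp only [LinearMap.smul_apply, ContinuousLinearMap.coe_coe, smul_eq_mul, this]
      ring)
  obtain ⟨x, hx⟩ := (WeakDual.CharacterSpace.homeoEval X ℂ).surjective
    (WeakDual.CharacterSpace.equivAlgHom.symm χ)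
  have hev : ∀ g, L g = L 1 * g x := fun g => by
    have : g x = χ g := DFunLike.congr_fun hx g
    rw [this]
    simp [χ, hc]
  refine ⟨x, L 1, ?_, hev⟩
  have hn := norm_eq_one_of_mem_extremePoints hL hL0
  have h1 : ‖L‖ ≤ ‖L 1‖ := L.opNorm_le_bound (norm_nonneg _) fun g => by
    rw [hev g, norm_mul]
    exact mul_le_mul_of_nonneg_left (g.norm_coe_le_norm x) (norm_nonneg _)
  have h2 : ‖L 1‖ ≤ ‖L‖ * 1 := L.le_of_opNorm_le_of_le le_rfl
    ((ContinuousMap.norm_le _ zero_le_one).2 fun x => by simp)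
  linarith

/-- The evaluation at `x` on a space of continuous functions. -/
def evalOn (J : E →ₗᵢ[ℂ] C(X, ℂ)) (x : X) : StrongDual ℂ E :=
  (ContinuousMap.evalCLM ℂ x).comp J.toContinuousLinearMap

@[simp]
theorem evalOn_apply (J : E →ₗᵢ[ℂ] C(X, ℂ)) (x : X) (e : E) : evalOn J x e = J e x := rfl

/-- The nonzero extreme points of the dual ball of a space of continuous functions are unimodular
multiples of evaluations. -/
theorem exists_eq_mul_evalOn [T2Space X] (J : E →ₗᵢ[ℂ] C(X, ℂ)) {φ : StrongDual ℂ E}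
    (hφ : φ ∈ Set.extremePoints ℝ (dualBall E)) (hφ0 : φ ≠ 0) :
    ∃ (x : X) (c : ℂ), ‖c‖ = 1 ∧ φ = c • evalOn J x := by
  let R : WeakDual ℂ C(X, ℂ) →L[ℝ] WeakDual ℂ E :=
    { toFun := fun L => StrongDual.toWeakDual
        ((WeakDual.toStrongDual L).comp J.toContinuousLinearMap)
      map_add' := fun _ _ => rfl
      map_smul' := fun _ _ => rfl
      cont := WeakDual.continuous_of_continuous_eval fun e => WeakDual.eval_continuous (J e) }
  -- Hahn–Banach gives surjectivity; an extreme point of an affine continuous image of a compact set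
  -- then lifts to an extreme point.
  have himage : R.toContinuousAffineMap '' weakDualBall C(X, ℂ) = weakDualBall E := by
    ext ψ
    constructor
    · rintro ⟨L, hL, rfl⟩
      refine ContinuousLinearMap.opNorm_le_bound _ zero_le_one fun e => ?_
      rw [← J.norm_map]
      exact (WeakDual.toStrongDual L).le_of_opNorm_le hL (J e)
    · intro hψ
      obtain ⟨L, hL, h⟩ := exists_extension_mem_dualBall J hψ
      exact ⟨StrongDual.toWeakDual L, hL, DFunLike.ext _ _ h⟩
  have hφ' := toWeakDual_mem_extremePoints hφ
  rw [← himage] at hφ'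
  obtain ⟨L, hL, hLφ⟩ := surjOn_extremePoints_image R.toContinuousAffineMap
    isCompact_weakDualBall hφ'
  have hLv : ∀ e, φ e = L (J e) := fun e => (DFunLike.congr_fun hLφ e).symm
  obtain ⟨x, c, hc, h⟩ := exists_eq_mul_eval (L := WeakDual.toStrongDual L) hL fun h0 => hφ0 (by
    ext e
    rw [hLv]
    exact DFunLike.congr_fun h0 (J e))
  refine ⟨x, c, hc, ?_⟩
  ext e
  rw [hLv]
  exact h (J e)

end ContinuousFunctions

/-- The norm of a vector is attained at an extreme point of the dual ball. -/
theorem exists_mem_extremePoints_apply_eq_norm (e : E) :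
    ∃ φ ∈ Set.extremePoints ℝ (dualBall E), ‖φ e‖ = ‖e‖ := by
  let R : WeakDual ℂ E →L[ℝ] ℝ :=
    { toFun := fun L => (L e).re
      map_add' := fun L₁ L₂ => Complex.add_re (L₁ e) (L₂ e)
      map_smul' := fun c L => by
        change (c • (L e)).re = c • (L e).re
        exact Complex.smul_re c (L e)
      cont := Complex.continuous_re.comp (WeakDual.eval_continuous e) }
  have hle : ∀ φ ∈ weakDualBall E, ‖φ e‖ ≤ ‖e‖ := fun φ hφ => by
    simpa using (WeakDual.toStrongDual φ).le_of_opNorm_le hφ e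
  -- `‖e‖` is the maximum of `Re φ(e)` over the ball, hence extreme in the image.
  have hmem : ‖e‖ ∈ Set.extremePoints ℝ (R.toContinuousAffineMap '' weakDualBall E) := by
    obtain ⟨ψ, hψ, hψe⟩ := exists_dual_vector'' ℂ e
    refine ⟨⟨StrongDual.toWeakDual ψ, hψ, ?_⟩, ?_⟩
    · change (ψ e).re = ‖e‖
      simp [hψe]
    · rintro _ ⟨φ₁, h₁, rfl⟩ _ ⟨φ₂, h₂, rfl⟩ ⟨a, b, ha, hb, hab, h⟩
      have e₁ : (φ₁ e).re ≤ ‖e‖ := (Complex.re_le_norm _).trans (hle φ₁ h₁)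
      have e₂ : (φ₂ e).re ≤ ‖e‖ := (Complex.re_le_norm _).trans (hle φ₂ h₂)
      change a * (φ₁ e).re + b * (φ₂ e).re = ‖e‖ at h
      change (φ₁ e).re = ‖e‖
      obtain rfl : b = 1 - a := by linarith
      nlinarith
  obtain ⟨φ, hφ, hφe⟩ := surjOn_extremePoints_image R.toContinuousAffineMap
    isCompact_weakDualBall hmem
  refine ⟨WeakDual.toStrongDual φ, hφ, (hle φ hφ.1).antisymm ?_⟩
  have : (φ e).re = ‖e‖ := hφe
  rw [← this]
  exact Complex.re_le_norm _

variable {X : Type*} [TopologicalSpace X] [CompactSpace X] [T2Space X]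

/-- The points whose evaluations are extreme functionals form a boundary. -/
theorem exists_evalOn_mem_extremePoints (J : E →ₗᵢ[ℂ] C(X, ℂ)) {e : E} (he : e ≠ 0) :
    ∃ x, evalOn J x ∈ Set.extremePoints ℝ (dualBall E) ∧ ‖J e x‖ = ‖e‖ := by
  obtain ⟨φ, hφ, hφe⟩ := exists_mem_extremePoints_apply_eq_norm e
  have hφ0 : φ ≠ 0 := by
    rintro rfl
    exact he (norm_eq_zero.1 (by simpa using hφe.symm))
  obtain ⟨x, c, hc, rfl⟩ := exists_eq_mul_evalOn J hφ hφ0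
  refine ⟨x, ?_, by simpa [hc] using hφe⟩
  have hc0 : c ≠ 0 := by rintro rfl; simp at hc
  have := smul_mem_extremePoints hφ (c := c⁻¹) (by simp [hc])
  rwa [inv_smul_smul₀ hc0] at this

/-- A linear isometry between spaces of continuous functions is a weighted composition at the
points whose evaluations are extreme. -/
theorem exists_apply_eq_mul {F Y : Type*} [NormedAddCommGroup F] [NormedSpace ℂ F]
    [TopologicalSpace Y] [CompactSpace Y] (J : E →ₗᵢ[ℂ] C(X, ℂ)) (J' : F →ₗᵢ[ℂ] C(Y, ℂ))
    (T : E ≃ₗᵢ[ℂ] F) {y : Y} (hy : evalOn J' y ∈ Set.extremePoints ℝ (dualBall F))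
    (hy0 : evalOn J' y ≠ 0) :
    ∃ (x : X) (c : ℂ), ‖c‖ = 1 ∧ ∀ e, J' (T e) y = c * J e x := by
  obtain ⟨x, c, hc, h⟩ := exists_eq_mul_evalOn J (comp_mem_extremePoints T hy) fun h0 => hy0 (by
    ext v
    simpa using DFunLike.congr_fun h0 (T.symm v))
  exact ⟨x, c, hc, fun e => by simpa using DFunLike.congr_fun h e⟩

end ExtremeFunctionals

theorem le_of_forall_pow_mul_le {u r c C : ℝ} (hr : 0 ≤ r) (hc : 0 < c)
    (h : ∀ n : ℕ, u ^ n * c ≤ r ^ n * C) : u ≤ r := by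
  by_contra! hlt
  have hu0 : 0 < u := hr.trans_lt hlt
  have hC : 0 < C := by simpa using hc.trans_le (by simpa using h 0)
  obtain ⟨n, hn⟩ := exists_pow_lt_of_lt_one (div_pos hc hC) ((div_lt_one hu0).2 hlt)
  rw [div_pow, div_lt_div_iff₀ (by positivity) hC] at hn
  linarith [h n]

/-! ### The modules `Af` and the sufficiency of the condition on `Q`. -/

section Modules

variable {K : Type*} [TopologicalSpace K] {A : Subalgebra ℂ C(K, ℂ)} {S : Set K}

theorem restrictHom_apply (a : A) (x : S) :
    restrictHom A S a x = (a : C(K, ℂ)) x := rfl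

/-- The element `a f` of `Af`. -/
def weighted (f : C(S, ℝ)) (a : A) : moduleOf A f := ⟨restrictHom A S a * toComplex f, a, rfl⟩

theorem weighted_apply (f : C(S, ℝ)) (a : A) (x : S) :
    (weighted f a : C(S, ℂ)) x = (a : C(K, ℂ)) x * (f x : ℂ) := rfl

theorem exists_eq_weighted (f : C(S, ℝ)) (h : moduleOf A f) : ∃ a, h = weighted f a := by
  obtain ⟨a, ha⟩ := h.2
  exact ⟨a, Subtype.ext ha⟩

instance (f : C(S, ℝ)) : SMul A (moduleOf A f) := (moduleOfModule A f).toSMul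

theorem coe_smul_moduleOf (f : C(S, ℝ)) (a : A) (h : moduleOf A f) :
    ((a • h : moduleOf A f) : C(S, ℂ)) = restrictHom A S a * (h : C(S, ℂ)) := rfl

theorem smul_weighted (f : C(S, ℝ)) (a b : A) : a • weighted f b = weighted f (a * b) :=
  Subtype.ext (by
    rw [coe_smul_moduleOf]
    simp only [weighted, map_mul, mul_assoc])

instance (f : C(S, ℝ)) : IsScalarTower ℂ A (moduleOf A f) :=
  ⟨fun c a h => Subtype.ext (by
    rw [coe_smul_moduleOf, Submodule.coe_smul, coe_smul_moduleOf, map_smul, smul_mul_assoc])⟩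

theorem inv_mem_Q {u : S → ℝ} (hu : u ∈ Q A S) : (fun x => (u x)⁻¹) ∈ Q A S := by
  obtain ⟨g, hg⟩ := hu
  refine ⟨g⁻¹, fun x => ?_⟩
  have h1 : ((g : A) : C(K, ℂ)) x * ((g⁻¹ : Aˣ) : A).1 x = 1 := by
    have : (g : A) * ((g⁻¹ : Aˣ) : A) = 1 := g.mul_inv
    exact DFunLike.congr_fun (congr_arg Subtype.val this) (x : K)
  change (u x)⁻¹ = _
  rw [hg, ← norm_inv, inv_eq_of_mul_eq_one_right h1]

theorem ModuleIsometric.linearlyIsometric {X Y : Type*} [SeminormedAddCommGroup X]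
    [SeminormedAddCommGroup Y] [Module ℂ X] [Module ℂ Y] [Module A X] [Module A Y]
    [IsScalarTower ℂ A X] [IsScalarTower ℂ A Y] (h : ModuleIsometric A X Y) :
    LinearlyIsometric X Y :=
  h.elim fun T => ⟨{ T.toLinearEquiv.restrictScalars ℂ with norm_map' := T.norm_map }⟩

/-- Multiplication by the unimodular `u = g f₂ / f₁` sends `a f₁` to `(a g) f₂`; its inverse uses
`g⁻¹`. -/
theorem moduleIsometric_of_div_mem_Q [CompactSpace S] {f₁ f₂ : C(S, ℝ)}
    (hf₁ : ∀ x, 0 < f₁ x) (hf₂ : ∀ x, 0 < f₂ x) (h : (fun x => f₁ x / f₂ x) ∈ Q A S) :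
    ModuleIsometric A (moduleOf A f₁) (moduleOf A f₂) := by
  obtain ⟨g, hg⟩ := h
  have hne₁ : ∀ x, (f₁ x : ℂ) ≠ 0 := fun x => by exact_mod_cast (hf₁ x).ne'
  have hne₂ : ∀ x, (f₂ x : ℂ) ≠ 0 := fun x => by exact_mod_cast (hf₂ x).ne'
  have hgg : ∀ x : S, ((g : A) : C(K, ℂ)) x * ((g⁻¹ : Aˣ) : A).1 x = 1 := fun x => by
    have : (g : A) * ((g⁻¹ : Aˣ) : A) = 1 := g.mul_inv
    exact DFunLike.congr_fun (congr_arg Subtype.val this) (x : K)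
  let u : C(S, ℂ) := ⟨fun x => ((g : A) : C(K, ℂ)) x * f₂ x / f₁ x, by
    refine Continuous.div ?_ ?_ hne₁
    · exact (((g : A) : C(K, ℂ)).continuous.comp continuous_subtype_val).mul
        (toComplex f₂).continuous
    · exact (toComplex f₁).continuous⟩
  let v : C(S, ℂ) := ⟨fun x => ((g⁻¹ : Aˣ) : A).1 x * f₁ x / f₂ x, by
    refine Continuous.div ?_ ?_ hne₂
    · exact (((g⁻¹ : Aˣ) : A).1.continuous.comp continuous_subtype_val).mul
        (toComplex f₁).continuous
    · exact (toComplex f₂).continuous⟩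
  have huv : u * v = 1 := by
    ext x
    change ((g : A) : C(K, ℂ)) x * f₂ x / f₁ x * (((g⁻¹ : Aˣ) : A).1 x * f₁ x / f₂ x) = 1
    have := hne₁ x
    have := hne₂ x
    field_simp
    exact hgg x
  have hun : ∀ x, ‖u x‖ = 1 := fun x => by
    change ‖((g : A) : C(K, ℂ)) x * f₂ x / f₁ x‖ = 1
    have h1 := (hf₁ x).ne'
    have h2 := (hf₂ x).ne'
    rw [norm_div, norm_mul, ← hg, Complex.norm_real, Complex.norm_real,
      Real.norm_of_nonneg (hf₁ x).le, Real.norm_of_nonneg (hf₂ x).le]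
    field_simp
  have hu : ∀ w ∈ moduleOf A f₁, w * u ∈ moduleOf A f₂ := by
    rintro _ ⟨a, rfl⟩
    refine ⟨a * g, ?_⟩
    ext x
    change (a : C(K, ℂ)) x * f₁ x * (((g : A) : C(K, ℂ)) x * f₂ x / f₁ x) =
      (a : C(K, ℂ)) x * ((g : A) : C(K, ℂ)) x * f₂ x
    have := hne₁ x
    field_simp
  have hv : ∀ w ∈ moduleOf A f₂, w * v ∈ moduleOf A f₁ := by
    rintro _ ⟨a, rfl⟩
    refine ⟨a * ((g⁻¹ : Aˣ) : A), ?_⟩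
    ext x
    change (a : C(K, ℂ)) x * f₂ x * (((g⁻¹ : Aˣ) : A).1 x * f₁ x / f₂ x) =
      (a : C(K, ℂ)) x * ((g⁻¹ : Aˣ) : A).1 x * f₁ x
    have := hne₂ x
    field_simp
  exact ⟨{
    toFun := fun w => ⟨w.1 * u, hu _ w.2⟩
    invFun := fun w => ⟨w.1 * v, hv _ w.2⟩
    map_add' := fun w z => Subtype.ext (add_mul w.1 z.1 u)
    map_smul' := fun a w => Subtype.ext (mul_assoc (restrictHom A S a) w.1 u)
    left_inv := fun w => Subtype.ext (by
      change w.1 * u * v = w.1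
      rw [mul_assoc, huv, mul_one])
    right_inv := fun w => Subtype.ext (by
      change w.1 * v * u = w.1
      rw [mul_assoc, mul_comm v, huv, mul_one])
    norm_map' := fun w => by
      change ‖w.1 * u‖ = ‖w.1‖
      refine le_antisymm ?_ ?_ <;>
        refine (ContinuousMap.norm_le _ (norm_nonneg _)).2 fun x => ?_
      · rw [ContinuousMap.mul_apply, norm_mul, hun, mul_one]
        exact w.1.norm_coe_le_norm x
      · refine le_trans (le_of_eq ?_) ((w.1 * u).norm_coe_le_norm x)
        rw [ContinuousMap.mul_apply, norm_mul, hun, mul_one] }⟩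

end Modules

/-! ### Density of the extreme points and the necessity of the condition. -/

section UniformAlgebras

variable {K : Type*} [TopologicalSpace K] [CompactSpace K] (A : Subalgebra ℂ C(K, ℂ))

/-- The inclusion of `A` in `C(K)`. -/
def inclusionIsometry : A →ₗᵢ[ℂ] C(K, ℂ) where
  toLinearMap := A.val.toLinearMap
  norm_map' _ := rfl

variable {A}

theorem exists_mem_choquetBoundary_norm_eq [T2Space K] {a : A} (ha : a ≠ 0) :
    ∃ x ∈ choquetBoundary A, ‖(a : C(K, ℂ)) x‖ = ‖a‖ :=
  exists_evalOn_mem_extremePoints (inclusionIsometry A) ha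

theorem norm_restrictHom [T2Space K] (a : A) : ‖restrictHom A (shilovBoundary A) a‖ = ‖a‖ := by
  apply le_antisymm
  · exact (ContinuousMap.norm_le _ (norm_nonneg _)).2 fun x =>
      (a : C(K, ℂ)).norm_coe_le_norm x
  · by_cases ha : a = 0
    · simp [ha]
    obtain ⟨x, hx, h⟩ := exists_mem_choquetBoundary_norm_eq ha
    rw [← h]
    exact (restrictHom A (shilovBoundary A) a).norm_coe_le_norm ⟨x, subset_closure hx⟩

theorem restrictHom_injective [T2Space K] :
    Function.Injective (restrictHom A (shilovBoundary A)) :=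
  (injective_iff_map_eq_zero _).2 fun a h => by
    rw [← norm_eq_zero, ← norm_restrictHom, h, norm_zero]

/-- The inclusion of `Af` in `C(∂A)`. -/
abbrev moduleInclusion (f : C(shilovBoundary A, ℝ)) :
    moduleOf A f →ₗᵢ[ℂ] C(shilovBoundary A, ℂ) :=
  (moduleOf A f).subtypeₗᵢ

/-- The points of `∂A` whose evaluations are extreme functionals on `Af`. -/
def extremeSet (f : C(shilovBoundary A, ℝ)) : Set (shilovBoundary A) :=
  {x | evalOn (moduleInclusion f) x ∈ Set.extremePoints ℝ (dualBall (moduleOf A f))}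

theorem evalOn_moduleInclusion_ne_zero {f : C(shilovBoundary A, ℝ)} (hf : ∀ x, 0 < f x)
    (x : shilovBoundary A) : evalOn (moduleInclusion f) x ≠ 0 := fun h => by
  have : ((1 : A) : C(K, ℂ)) x * (f x : ℂ) = 0 := DFunLike.congr_fun h (weighted f 1)
  simp [(hf x).ne'] at this

/-- Apply the boundary property of `Af` to `aⁿ f`: the weight `f` contributes only constants, which
disappear under `n`-th roots. -/
theorem norm_le_of_forall_mem_extremeSet [T2Space K] {f : C(shilovBoundary A, ℝ)}
    (hf : ∀ x, 0 < f x) (a : A) {r : ℝ} (hr : 0 ≤ r)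
    (h : ∀ x ∈ extremeSet f, ‖(a : C(K, ℂ)) x‖ ≤ r) (y : shilovBoundary A) :
    ‖(a : C(K, ℂ)) y‖ ≤ r := by
  refine le_of_forall_pow_mul_le hr (hf y) (C := ‖f‖) fun n => ?_
  have h1 : ‖(a : C(K, ℂ)) y‖ ^ n * f y ≤ ‖weighted f (a ^ n)‖ := by
    have := (weighted f (a ^ n) : C(shilovBoundary A, ℂ)).norm_coe_le_norm y
    rwa [weighted_apply, SubmonoidClass.coe_pow, ContinuousMap.pow_apply, norm_mul, norm_pow,
      Complex.norm_real, Real.norm_of_nonneg (hf y).le] at this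
  refine h1.trans ?_
  by_cases h0 : weighted f (a ^ n) = 0
  · rw [h0, norm_zero]
    positivity
  obtain ⟨x, hx, hxn⟩ := exists_evalOn_mem_extremePoints (moduleInclusion f) h0
  rw [← hxn]
  change ‖((a ^ n : A) : C(K, ℂ)) x * (f x : ℂ)‖ ≤ _
  rw [SubmonoidClass.coe_pow, ContinuousMap.pow_apply, norm_mul, norm_pow, Complex.norm_real]
  exact mul_le_mul (pow_le_pow_left₀ (norm_nonneg _) (h x hx) n) (f.norm_coe_le_norm x)
    (norm_nonneg _) (pow_nonneg hr n)

/-- The closure `F` of the extreme points norms `A`, so `A` embeds isometrically in `C(F)`. An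
extreme evaluation of `A` is then a multiple of one at a point of `F`; constants and separation
identify the two points. -/
theorem dense_extremeSet [T2Space K] (hA : A.SeparatesPoints) {f : C(shilovBoundary A, ℝ)}
    (hf : ∀ x, 0 < f x) : Dense (extremeSet f) := by
  set F : Set K := closure (Subtype.val '' extremeSet f)
  have : CompactSpace F := isCompact_iff_compactSpace.mp isClosed_closure.isCompact
  let J : A →ₗᵢ[ℂ] C(F, ℂ) :=
    { toLinearMap := (restrictHom A F).toLinearMap
      norm_map' := fun a => by
        refine le_antisymm ((ContinuousMap.norm_le _ (norm_nonneg _)).2 fun x =>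
          (a : C(K, ℂ)).norm_coe_le_norm x) ?_
        rw [← norm_restrictHom]
        refine (ContinuousMap.norm_le _ (norm_nonneg _)).2 fun y =>
          norm_le_of_forall_mem_extremeSet hf a (norm_nonneg _) (fun x hx => ?_) y
        exact (restrictHom A F a).norm_coe_le_norm
          ⟨x, subset_closure (Set.mem_image_of_mem _ hx)⟩ }
  have hsub : choquetBoundary A ⊆ F := by
    intro y hy
    obtain ⟨x, c, -, h⟩ := exists_eq_mul_evalOn J hy fun h0 =>
      one_ne_zero (α := ℂ) (DFunLike.congr_fun h0 1)
    have hv : ∀ a : A, (a : C(K, ℂ)) y = c * (a : C(K, ℂ)) x := fun a => DFunLike.congr_fun h a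
    have hc : c = 1 := by simpa using (hv 1).symm
    have hxy : (x : K) = y := by
      by_contra hne
      obtain ⟨_, ⟨a, ha, rfl⟩, hsep⟩ := hA hne
      exact hsep (by simpa [hc] using (hv ⟨a, ha⟩).symm)
    exact hxy ▸ x.2
  intro y
  rw [closure_subtype]
  exact closure_minimal hsub isClosed_closure y.2

theorem eq_of_forall_mem_extremeSet [T2Space K] (hA : A.SeparatesPoints)
    {f : C(shilovBoundary A, ℝ)} (hf : ∀ x, 0 < f x) {Y : Type*} [TopologicalSpace Y] [T2Space Y]
    {u v : shilovBoundary A → Y} (hu : Continuous u) (hv : Continuous v)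
    (h : ∀ x ∈ extremeSet f, u x = v x) (x : shilovBoundary A) : u x = v x :=
  congr_fun (Continuous.ext_on (dense_extremeSet hA hf) hu hv h) x

theorem mem_Q_of_mul_eq_one [T2Space K] {h k : A}
    (hk : ∀ x : shilovBoundary A, (h : C(K, ℂ)) x * (k : C(K, ℂ)) x = 1)
    {u : shilovBoundary A → ℝ} (hu : ∀ x, u x = ‖(h : C(K, ℂ)) x‖) :
    u ∈ Q A (shilovBoundary A) := by
  have : h * k = 1 := restrictHom_injective (ContinuousMap.ext fun x => by
    simpa [restrictHom_apply] using hk x)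
  exact ⟨⟨h, k, this, by rw [mul_comm, this]⟩, hu⟩

theorem LinearlyIsometric.mem_Q [T2Space K] (hA : A.SeparatesPoints)
    {f : C(shilovBoundary A, ℝ)} (hf : ∀ x, 0 < f x) (hT : LinearlyIsometric A (moduleOf A f)) :
    ⇑f ∈ Q A (shilovBoundary A) := by
  obtain ⟨T⟩ := hT
  obtain ⟨h, hh⟩ := exists_eq_weighted f (T 1)
  obtain ⟨b, hb⟩ := T.surjective (weighted f 1)
  obtain ⟨k, hk⟩ := exists_eq_weighted f (T (b * b))
  have key : ∀ x ∈ extremeSet f, ∃ c : ℂ, ∃ y : K, ‖c‖ = 1 ∧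
      ∀ a, (T a : C(shilovBoundary A, ℂ)) x = c * (a : C(K, ℂ)) y := fun x hx => by
    obtain ⟨y, c, hc, h⟩ := exists_apply_eq_mul (inclusionIsometry A) (moduleInclusion f) T hx
      (evalOn_moduleInclusion_ne_zero hf x)
    exact ⟨c, y, hc, h⟩
  have hcont : ∀ a : A, Continuous fun x : shilovBoundary A => (a : C(K, ℂ)) x := fun a =>
    (a : C(K, ℂ)).continuous.comp continuous_subtype_val
  have hinv : ∀ x : shilovBoundary A, (h : C(K, ℂ)) x * (k : C(K, ℂ)) x = 1 :=
    eq_of_forall_mem_extremeSet hA hf ((hcont h).mul (hcont k)) continuous_const fun x hx => by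
      obtain ⟨c, y, hc, hT⟩ := key x hx
      have hfx : (f x : ℂ) ≠ 0 := by exact_mod_cast (hf x).ne'
      have e1 := hT 1
      have e2 := hT b
      have e3 := hT (b * b)
      rw [hh, weighted_apply] at e1
      rw [hb, weighted_apply] at e2
      rw [hk, weighted_apply] at e3
      simp only [OneMemClass.coe_one, ContinuousMap.one_apply, MulMemClass.coe_mul,
        ContinuousMap.mul_apply, one_mul, mul_one] at e1 e2 e3
      -- With `h f = c`, `f = c b(y)` and `k f = c b(y)²`, both sides times `f²` equal `c² b(y)²`.
      apply mul_right_cancel₀ (mul_ne_zero hfx hfx)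
      calc _ = ((h : C(K, ℂ)) x * f x) * ((k : C(K, ℂ)) x * f x) := by ring
        _ = 1 * (f x * f x) := by rw [e1, e3, e2]; ring
  refine mem_Q_of_mul_eq_one (h := k) (k := h) (fun x => by rw [mul_comm, hinv]) ?_
  have hnorm : ∀ x : shilovBoundary A, ‖(h : C(K, ℂ)) x‖ * f x = 1 :=
    eq_of_forall_mem_extremeSet hA hf ((hcont h).norm.mul f.continuous) continuous_const
      fun x hx => by
        obtain ⟨c, y, hc, hT⟩ := key x hx
        have e1 := congr_arg norm (hT 1)
        rw [hh, weighted_apply] at e1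
        simpa [hc, abs_of_pos (hf x)] using e1
  intro x
  have e := congr_arg norm (hinv x)
  rw [norm_mul, norm_one] at e
  have hx : ‖(h : C(K, ℂ)) x‖ ≠ 0 := left_ne_zero_of_mul_eq_one e
  exact mul_left_cancel₀ hx ((hnorm x).trans e.symm)

theorem ModuleIsometric.div_mem_Q [T2Space K] (hA : A.SeparatesPoints)
    {f₁ f₂ : C(shilovBoundary A, ℝ)} (hf₁ : ∀ x, 0 < f₁ x) (hf₂ : ∀ x, 0 < f₂ x)
    (hT : ModuleIsometric A (moduleOf A f₁) (moduleOf A f₂)) :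
    (fun x => f₁ x / f₂ x) ∈ Q A (shilovBoundary A) := by
  obtain ⟨T⟩ := hT
  let T' : moduleOf A f₁ ≃ₗᵢ[ℂ] moduleOf A f₂ :=
    { T.toLinearEquiv.restrictScalars ℂ with norm_map' := T.norm_map }
  obtain ⟨h, hh⟩ := exists_eq_weighted f₂ (T (weighted f₁ 1))
  have hTa : ∀ a, T (weighted f₁ a) = weighted f₂ (a * h) := fun a => by
    rw [← smul_weighted, ← hh, ← map_smul, smul_weighted, mul_one]
  have hne : ∀ x, (f₂ x : ℂ) ≠ 0 := fun x => by exact_mod_cast (hf₂ x).ne'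
  obtain ⟨w, hw⟩ := T.surjective (weighted f₂ 1)
  obtain ⟨k, rfl⟩ := exists_eq_weighted f₁ w
  refine mem_Q_of_mul_eq_one (h := h) (k := k) (fun x => ?_) ?_
  · have e := DFunLike.congr_fun (congr_arg Subtype.val ((hTa k).symm.trans hw)) x
    rw [weighted_apply, weighted_apply] at e
    have e := mul_right_cancel₀ (hne x) e
    rw [mul_comm]
    simpa using e
  · refine eq_of_forall_mem_extremeSet hA hf₂
      (f₁.continuous.div f₂.continuous fun x => (hf₂ x).ne')
      ((h : C(K, ℂ)).continuous.comp continuous_subtype_val).norm fun x hx => ?_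
    obtain ⟨y, c, hc, hv⟩ := exists_apply_eq_mul (moduleInclusion f₁) (moduleInclusion f₂) T' hx
      (evalOn_moduleInclusion_ne_zero hf₂ x)
    have hv' : ∀ a : A, (a : C(K, ℂ)) x * (h : C(K, ℂ)) x * f₂ x =
        c * ((a : C(K, ℂ)) y * f₁ y) := fun a => by
      have e := hv (weighted f₁ a)
      change (T (weighted f₁ a) : C(shilovBoundary A, ℂ)) x = _ at e
      rw [hTa] at e
      exact e
    have h1 : (h : C(K, ℂ)) x * f₂ x = c * f₁ y := by simpa using hv' 1
    have hc0 : c ≠ 0 := by rintro rfl; simp at hc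
    have hne1 : c * (f₁ y : ℂ) ≠ 0 := mul_ne_zero hc0 (by exact_mod_cast (hf₁ y).ne')
    -- Dividing the formula for `a` by the one for `1` leaves `a(x) = a(y)`.
    have hxy : (x : K) = y := by
      by_contra hxy
      obtain ⟨_, ⟨a, ha, rfl⟩, hsep⟩ := hA hxy
      refine hsep (mul_right_cancel₀ hne1 ?_)
      have e := hv' ⟨a, ha⟩
      rw [mul_assoc, h1] at e
      rw [e]
      ring
    obtain rfl : x = y := Subtype.ext hxy
    rw [div_eq_iff (hf₂ x).ne']
    have e := congr_arg norm h1
    simpa [hc, abs_of_pos (hf₁ x), abs_of_pos (hf₂ x)] using e.symm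

theorem moduleIsometric_moduleOf_one [T2Space K] :
    ModuleIsometric A A (moduleOf A (1 : C(shilovBoundary A, ℝ))) := by
  have hcoe : ∀ a : A, (weighted (1 : C(shilovBoundary A, ℝ)) a : C(shilovBoundary A, ℂ)) =
      restrictHom A (shilovBoundary A) a := fun a => by
    ext x
    simp [weighted_apply, restrictHom_apply]
  let T : A →ₗ[A] moduleOf A (1 : C(shilovBoundary A, ℝ)) :=
    { toFun := weighted 1
      map_add' := fun a b => Subtype.ext (by
        rw [Submodule.coe_add, hcoe, hcoe, hcoe, map_add])
      map_smul' := fun a b => (smul_weighted 1 a b).symm }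
  have hT : ∀ a, ‖T a‖ = ‖a‖ := fun a => by
    rw [← norm_restrictHom, ← hcoe]
    rfl
  refine ⟨{ LinearEquiv.ofBijective T ⟨fun a b h => restrictHom_injective ?_, fun w => ?_⟩ with
    norm_map' := hT }⟩
  · rw [← hcoe, ← hcoe]
    exact congr_arg Subtype.val h
  · obtain ⟨a, rfl⟩ := exists_eq_weighted 1 w
    exact ⟨a, rfl⟩

end UniformAlgebras

end FunctionAlgebra

end

theorem mainTheorem2 {K : Type*} [TopologicalSpace K] [CompactSpace K] [T2Space K]
    (A : Subalgebra ℂ C(K, ℂ)) (hA : A.SeparatesPoints) :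
    (∀ f : C(FunctionAlgebra.shilovBoundary A, ℝ), (∀ x, 0 < f x) →
      List.TFAE [
        ⇑f ∈ FunctionAlgebra.Q A (FunctionAlgebra.shilovBoundary A),
        FunctionAlgebra.ModuleIsometric A A (FunctionAlgebra.moduleOf A f),
        FunctionAlgebra.LinearlyIsometric A (FunctionAlgebra.moduleOf A f)]) ∧
    (∀ f₁ f₂ : C(FunctionAlgebra.shilovBoundary A, ℝ), (∀ x, 0 < f₁ x) → (∀ x, 0 < f₂ x) →
      (FunctionAlgebra.ModuleIsometric A
          (FunctionAlgebra.moduleOf A f₁) (FunctionAlgebra.moduleOf A f₂) ↔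
        (fun x => f₁ x / f₂ x) ∈ FunctionAlgebra.Q A (FunctionAlgebra.shilovBoundary A))) := by
  refine ⟨fun f hf => ?_, fun f₁ f₂ hf₁ hf₂ =>
    ⟨FunctionAlgebra.ModuleIsometric.div_mem_Q hA hf₁ hf₂,
      FunctionAlgebra.moduleIsometric_of_div_mem_Q hf₁ hf₂⟩⟩
  tfae_have 1 → 2 := fun h => by
    -- The isometry from `A · 1` to `Af` requires the quotient `1 / f`, which is in `Q` because `Q`
    -- is closed under inverses.
    have h1 : (fun x => (1 : C(FunctionAlgebra.shilovBoundary A, ℝ)) x / f x) ∈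
        FunctionAlgebra.Q A (FunctionAlgebra.shilovBoundary A) := by
      simpa using FunctionAlgebra.inv_mem_Q h
    obtain ⟨T₁⟩ := FunctionAlgebra.moduleIsometric_moduleOf_one (A := A)
    obtain ⟨T₂⟩ := FunctionAlgebra.moduleIsometric_of_div_mem_Q (fun _ => zero_lt_one) hf h1
    exact ⟨T₁.trans T₂⟩
  tfae_have 2 → 3 := FunctionAlgebra.ModuleIsometric.linearlyIsometric
  tfae_have 3 → 1 := FunctionAlgebra.LinearlyIsometric.mem_Q hA hf
  tfae_finish
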